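/- **Theorem 3.3.** For $g:\mathbb R^d\to\mathbb C$ integrable write $\widehat g(\xi)=\int_{\mathbb R^d} g(x)e^{-ix\cdot\xi}\,dx$, and for $s>0$ let $\Lambda^s=(-\Delta)^{s/2}$ be the Fourier multiplier with symbol $|\xi|^s$, i.e. $\widehat{\Lambda^s f}(\xi)=|\xi|^s\widehat f(\xi)$. Let $d\ge 1$ be an integer and let $s>2$ be real. There exists $p_1$ with $1<p_1<2$, depending only on $(s,d)$, such that for every $p\in(1,p_1]$ the following two assertions hold. (i) There are a constant $C_{p,d,s}>0$, depending only on $(p,d,s)$, and a function $f\in C_c^\infty(\mathbb R^d,\mathbb R)$ such that $$\int_{\mathbb R^d}(\Lambda^s f)\,|f|^{p-2}f\,dx\le -C_{p,d,s}<0 .$$ (ii) There are constants $D_1,D_2,\alpha_1,\alpha_2>0$, depending only on $(p,d,s)$, a sequence of positive numbers $N_j\to\infty$, and a sequence of Schwartz functions $f_j:\mathbb R^d\to\mathbb R$ such that for every $j$ $$\operatorname{supp}(\widehat{f_j})\subset\{\xi\in\mathbb R^d:\ \alpha_1N_j<|\xi|<\alpha_2N_j\}$$ and $$-D_2<\frac{\int_{\mathbb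 R^d}(\Lambda^s f_j)\,|f_j|^{p-2}f_j\,dx}{N_j^s\int_{\mathbb R^d}|f_j|^p\,dx}<-D_1<0 .$$ Here $|f|^{p-2}f$ is understood to be $0$ where $f=0$. -/

import Mathlib

open scoped ContDiff FourierTransform

/-- The fractional Laplacian `Λ^s = (-Δ)^{s/2}` of a complex-valued function on `ℝ^d`: the Fourier
multiplier with symbol `|ζ|^s`, where `ζ` is the angular frequency. Mathlib's Fourier transform has
the kernel `exp (-2πi ⟨x, ξ⟩)`, so that `ζ = 2π ξ`. -/
noncomputable def fracLaplacianC {d : ℕ} (s : ℝ) (f : EuclideanSpace ℝ (Fin d) → ℂ) :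
    EuclideanSpace ℝ (Fin d) → ℂ :=
  𝓕⁻ (fun ξ : EuclideanSpace ℝ (Fin d) => (((2 * Real.pi * ‖ξ‖) ^ s : ℝ) : ℂ) * 𝓕 f ξ)

/-- The fractional Laplacian `Λ^s f` of a real-valued function, as a real-valued function. Taking
the real part loses nothing, see `ofReal_fracLaplacian`. -/
noncomputable def fracLaplacian {d : ℕ} (s : ℝ) (f : EuclideanSpace ℝ (Fin d) → ℝ) :
    EuclideanSpace ℝ (Fin d) → ℝ :=
  fun x => (fracLaplacianC s (fun y => (f y : ℂ)) x).re

theorem fracLaplacianC_conj {d : ℕ} (s : ℝ) (f : EuclideanSpace ℝ (Fin d) → ℝ)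
    (x : EuclideanSpace ℝ (Fin d)) :
    (starRingEnd ℂ) (fracLaplacianC s (fun y => (f y : ℂ)) x) =
      fracLaplacianC s (fun y => (f y : ℂ)) x := by
  have h1 : ∀ ξ : EuclideanSpace ℝ (Fin d), (starRingEnd ℂ) (𝓕 (fun y => (f y : ℂ)) ξ) =
      𝓕 (fun y => (f y : ℂ)) (-ξ) := by
    intro ξ
    rw [Real.fourier_eq', Real.fourier_eq', ← integral_conj]
    congr 1
    funext v
    simp [← Complex.exp_conj, Complex.conj_ofNat]
  unfold fracLaplacianC
  rw [Real.fourierInv_eq', ← integral_conj, ← MeasureTheory.integral_neg_eq_self]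
  congr 1
  funext v
  simp [← Complex.exp_conj, Complex.conj_ofNat, h1]

/-- For real-valued `f`, the function `Λ^s f` is real-valued. -/
theorem ofReal_fracLaplacian {d : ℕ} (s : ℝ) (f : EuclideanSpace ℝ (Fin d) → ℝ)
    (x : EuclideanSpace ℝ (Fin d)) :
    ((fracLaplacian s f x : ℝ) : ℂ) = fracLaplacianC s (fun y => (f y : ℂ)) x :=
  Complex.conj_eq_iff_re.mp (fracLaplacianC_conj s f x)

/-- The quantity `∫_{ℝ^d} (Λ^s f) |f|^{p-2} f dx`. -/
noncomputable def bernsteinForm {d : ℕ} (s p : ℝ) (f : EuclideanSpace ℝ (Fin d) → ℝ) : ℝ :=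
  ∫ x, fracLaplacian s f x * (|f x| ^ (p - 2) * f x)

/-! The mechanism is one-dimensional. On the circle take `sin θ - a sin 3θ` with `0 < a < 1/3`. It
is positive on `(0, π)` and antiperiodic with antiperiod `π`. The multiplier `|k|^s` turns it into
`sin θ - a 3^s sin 3θ`. As `p → 1⁺` the signed power of the wave tends to its sign, so the form over
a half period tends to `∫₀^π (sin θ - a 3^s sin 3θ) dθ = 2 - (2/3) a 3^s`. This is negative once `a
> 3 / 3^s`, and such an `a < 1/3` exists because `3^s > 9`, that is, because `s > 2`. Hence some
`p₁` works for all `p ∈ (1, p₁]` (`exists_integral_waveDensity_neg`).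

To pass to `ℝ^d`, multiply the wave in `2πN⟨e, x⟩ + τ` by a Schwartz envelope `φ`. For large `N`,
`Λ^s` acts on the carrier alone, up to a uniform error `o(N^s)`
(`exists_tendsto_abs_fracLaplacian_wavePacket_sub_le`). Averaging the main term over the phase `τ`
gives the circle integral times `∫ |φ|^p`, so some `τ` makes it negative
(`exists_integral_waveDensity_mul_le`); no equidistribution argument is needed. For large `N` the
error cannot restore the sign (`eventually_exists_bernsteinForm_wavePacket_neg`).

A compactly supported `φ` gives (i). A band-limited `φ` gives a packet with spectrum in an annulus.
Its dilates have a constant normalized ratio (`bernsteinForm_comp_smul_div`), which gives (ii). -/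

open MeasureTheory Filter Topology

/-! ### Signed powers -/

/-- The odd power `|y|^{p-2} y`. -/
noncomputable def signedPow (p y : ℝ) : ℝ := |y| ^ (p - 2) * y

theorem signedPow_neg (p y : ℝ) : signedPow p (-y) = -signedPow p y := by
  simp [signedPow]

theorem signedPow_mul (p x y : ℝ) : signedPow p (x * y) = signedPow p x * signedPow p y := by
  simp only [signedPow, abs_mul, Real.mul_rpow (abs_nonneg x) (abs_nonneg y)]
  ring

theorem abs_signedPow {p : ℝ} (hp : 1 < p) (y : ℝ) : |signedPow p y| = |y| ^ (p - 1) := by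
  rcases eq_or_ne y 0 with rfl | hy
  · simp [signedPow, Real.zero_rpow (by linarith : p - 1 ≠ 0)]
  · rw [signedPow, abs_mul, abs_of_nonneg (Real.rpow_nonneg (abs_nonneg y) _),
      ← Real.rpow_add_one (abs_ne_zero.mpr hy)]
    congr 1; ring

theorem mul_signedPow {p : ℝ} (hp : 1 < p) (y : ℝ) : y * signedPow p y = |y| ^ p := by
  rcases eq_or_ne y 0 with rfl | hy
  · simp [Real.zero_rpow (by linarith : p ≠ 0)]
  · have : y * signedPow p y = |y| ^ (p - 2) * |y| ^ (2 : ℕ) := by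
      rw [signedPow, sq_abs]; ring
    rw [this, ← Real.rpow_natCast, ← Real.rpow_add (abs_pos.mpr hy)]
    congr 1; push_cast; ring

theorem signedPow_of_pos {p y : ℝ} (hy : 0 < y) : signedPow p y = y ^ (p - 1) := by
  rw [signedPow, abs_of_pos hy, ← Real.rpow_add_one hy.ne']
  congr 1; ring

theorem measurable_signedPow (p : ℝ) : Measurable (signedPow p) := by
  unfold signedPow
  fun_prop

/-! ### The model problem on the circle -/

/-- The trigonometric polynomial `sin θ - a sin 3θ`. -/
noncomputable def trigWave (a θ : ℝ) : ℝ := Real.sin θ - a * Real.sin (3 * θ)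

theorem continuous_trigWave (a : ℝ) : Continuous (trigWave a) := by
  unfold trigWave; fun_prop

theorem contDiff_trigWave (a : ℝ) : ContDiff ℝ ∞ (trigWave a) := by
  unfold trigWave; fun_prop

theorem trigWave_add_pi (a θ : ℝ) : trigWave a (θ + Real.pi) = -trigWave a θ := by
  have : 3 * (θ + Real.pi) = 3 * θ + Real.pi + 2 * Real.pi := by ring
  rw [trigWave, trigWave, this, Real.sin_add_two_pi, Real.sin_add_pi, Real.sin_add_pi]
  ring

theorem abs_trigWave_le (a θ : ℝ) : |trigWave a θ| ≤ 1 + |a| := by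
  refine (abs_sub _ _).trans (add_le_add (Real.abs_sin_le_one _) ?_)
  rw [abs_mul]
  exact mul_le_of_le_one_right (abs_nonneg a) (Real.abs_sin_le_one _)

/-- The triple-angle formula factors the wave as `sin θ (1 - 3a + 4a sin² θ)`; this is where `a <
1/3` enters. -/
theorem trigWave_pos {a θ : ℝ} (ha0 : 0 < a) (ha : a < 1 / 3) (h0 : 0 < θ) (h1 : θ < Real.pi) :
    0 < trigWave a θ := by
  have hsin := Real.sin_pos_of_pos_of_lt_pi h0 h1
  have : trigWave a θ = Real.sin θ * (1 - 3 * a + 4 * a * Real.sin θ ^ 2) := by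
    rw [trigWave, Real.sin_three_mul]; ring
  rw [this]
  have : 0 < a * Real.sin θ ^ 2 := by positivity
  exact mul_pos hsin (by linarith)

/-- The product of a trigonometric wave with the signed power of another one. -/
noncomputable def waveDensity (a b p θ : ℝ) : ℝ := trigWave b θ * signedPow p (trigWave a θ)

/-- Both factors change sign under a shift by `π`. Hence it suffices to integrate over `(0, π)`,
where the wave is positive. -/
theorem waveDensity_periodic (a b p : ℝ) : Function.Periodic (waveDensity a b p) Real.pi := by
  intro θ
  simp only [waveDensity, trigWave_add_pi, signedPow_neg]
  ring

theorem measurable_waveDensity (a b p : ℝ) : Measurable (waveDensity a b p) :=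
  (continuous_trigWave b).measurable.mul
    ((measurable_signedPow p).comp (continuous_trigWave a).measurable)

theorem abs_signedPow_trigWave_le (a : ℝ) {p : ℝ} (hp : 1 < p) (θ : ℝ) :
    |signedPow p (trigWave a θ)| ≤ (1 + |a|) ^ (p - 1) := by
  rw [abs_signedPow hp]
  exact Real.rpow_le_rpow (abs_nonneg _) (abs_trigWave_le a θ) (by linarith)

theorem abs_waveDensity_le (a b : ℝ) {p : ℝ} (hp : 1 < p) (θ : ℝ) :
    |waveDensity a b p θ| ≤ (1 + |b|) * (1 + |a|) ^ (p - 1) := by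
  rw [waveDensity, abs_mul]
  exact mul_le_mul (abs_trigWave_le b θ) (abs_signedPow_trigWave_le a hp θ) (abs_nonneg _)
    (by positivity)

theorem integral_trigWave (a : ℝ) :
    ∫ θ in (0 : ℝ)..Real.pi, trigWave a θ = 2 - a * (2 / 3) := by
  have h3 : ∫ θ in (0 : ℝ)..Real.pi, Real.sin (3 * θ) = 2 / 3 := by
    rw [intervalIntegral.integral_comp_mul_left _ (by norm_num : (3 : ℝ) ≠ 0), integral_sin,
      show 3 * Real.pi = Real.pi + 2 * Real.pi by ring, Real.cos_add_two_pi]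
    norm_num
  unfold trigWave
  rw [intervalIntegral.integral_sub, intervalIntegral.integral_const_mul, h3, integral_sin]
  · norm_num
  · exact Real.continuous_sin.intervalIntegrable _ _
  · exact Continuous.intervalIntegrable (by fun_prop) _ _

/-- On `(0, π)` the signed power is an honest power with exponent `p - 1 → 0`, so it tends to `1`;
dominated convergence does the rest. -/
theorem tendsto_integral_waveDensity {a : ℝ} (ha0 : 0 < a) (ha : a < 1 / 3) (b : ℝ) :
    Tendsto (fun p => ∫ θ in (0 : ℝ)..Real.pi, waveDensity a b p θ) (𝓝[>] 1)
      (𝓝 (2 - b * (2 / 3))) := by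
  rw [← integral_trigWave b]
  refine intervalIntegral.tendsto_integral_filter_of_dominated_convergence
    (fun _ => (1 + |b|) * (1 + |a|)) ?_ ?_ (by simp) ?_
  · exact Eventually.of_forall fun p => (measurable_waveDensity a b p).aestronglyMeasurable
  · have : Set.Ioo (1 : ℝ) 2 ∈ 𝓝[>] (1 : ℝ) := Ioo_mem_nhdsGT (by norm_num)
    filter_upwards [this] with p hp
    refine Eventually.of_forall fun θ _ => (abs_waveDensity_le a b hp.1 θ).trans ?_
    gcongr
    calc (1 + |a|) ^ (p - 1) ≤ (1 + |a|) ^ (1 : ℝ) :=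
          Real.rpow_le_rpow_of_exponent_le (by linarith [abs_nonneg a]) (by linarith [hp.2])
      _ = 1 + |a| := Real.rpow_one _
  -- The endpoint `π` lies in the half-open interval, but the wave vanishes there.
  · have hpi : ∀ᵐ θ : ℝ, θ ≠ Real.pi := by simp [ae_iff]
    filter_upwards [hpi] with θ hne hθ
    rw [Set.uIoc_of_le Real.pi_pos.le] at hθ
    have hpos := trigWave_pos ha0 ha hθ.1 (lt_of_le_of_ne hθ.2 hne)
    simp only [waveDensity, signedPow_of_pos hpos]
    have : ContinuousAt (fun p : ℝ => trigWave b θ * trigWave a θ ^ (p - 1)) 1 := by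
      have : trigWave a θ ≠ 0 := hpos.ne'
      exact continuousAt_const.mul
        (ContinuousAt.rpow continuousAt_const (by fun_prop) (Or.inl this))
    simpa using this.tendsto.mono_left nhdsWithin_le_nhds

theorem exists_integral_waveDensity_neg {s : ℝ} (hs : 2 < s) :
    ∃ a p₁ : ℝ, 1 < p₁ ∧ p₁ < 2 ∧ ∀ p, 1 < p → p ≤ p₁ →
      ∫ θ in (0 : ℝ)..Real.pi, waveDensity a (a * 3 ^ s) p θ < 0 := by
  have h3 : (3 : ℝ) * 3 < 3 ^ s := by
    calc (3 : ℝ) * 3 = 3 ^ (2 : ℝ) := by norm_num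
      _ < 3 ^ s := Real.rpow_lt_rpow_of_exponent_lt (by norm_num) hs
  have hlt : 3 / (3 : ℝ) ^ s < 1 / 3 := by
    rw [div_lt_div_iff₀ (by positivity) (by norm_num)]; linarith
  obtain ⟨a, ha, ha'⟩ := exists_between hlt
  have ha0 : 0 < a := lt_trans (by positivity) ha
  have hneg : 2 - a * 3 ^ s * (2 / 3) < 0 := by
    rw [div_lt_iff₀ (by positivity)] at ha; linarith
  have hev := (tendsto_integral_waveDensity ha0 ha' (a * 3 ^ s)).eventually (gt_mem_nhds hneg)
  obtain ⟨u, hu, hsub⟩ := mem_nhdsGT_iff_exists_Ioo_subset.mp hev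
  have hu : 1 < u := hu
  -- The midpoint keeps `p ≤ p₁` strictly below `u`; the cap `3 / 2` ensures `p₁ < 2`.
  refine ⟨a, min ((1 + u) / 2) (3 / 2), lt_min (by linarith) (by norm_num),
    (min_le_right _ _).trans_lt (by norm_num), fun p hp hp1 => hsub ⟨hp, ?_⟩⟩
  have := hp1.trans (min_le_left _ _)
  linarith

/-! ### Plane waves and the action of the multiplier at high frequency -/

section FourierSide

variable {d : ℕ}

/-- The plane wave `x ↦ exp (2πi ⟨v, x⟩)`. -/
noncomputable def planeWave (v x : EuclideanSpace ℝ (Fin d)) : ℂ :=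
  Complex.exp (((2 * Real.pi * inner ℝ v x : ℝ) : ℂ) * Complex.I)

theorem norm_planeWave (v x : EuclideanSpace ℝ (Fin d)) : ‖planeWave v x‖ = 1 :=
  Complex.norm_exp_ofReal_mul_I _

theorem continuous_planeWave (v : EuclideanSpace ℝ (Fin d)) : Continuous (planeWave v) := by
  unfold planeWave; fun_prop

theorem planeWave_add (v w x : EuclideanSpace ℝ (Fin d)) :
    planeWave (v + w) x = planeWave v x * planeWave w x := by
  rw [planeWave, planeWave, planeWave, ← Complex.exp_add, inner_add_left]
  congr 1; push_cast; ring

theorem fourier_eq_planeWave (f : EuclideanSpace ℝ (Fin d) → ℂ)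
    (ξ : EuclideanSpace ℝ (Fin d)) : 𝓕 f ξ = ∫ x, planeWave (-ξ) x * f x := by
  rw [Real.fourier_eq']
  simp only [planeWave, inner_neg_left, real_inner_comm ξ, smul_eq_mul, mul_neg, neg_mul]

theorem fourierInv_eq_planeWave (f : EuclideanSpace ℝ (Fin d) → ℂ)
    (x : EuclideanSpace ℝ (Fin d)) : 𝓕⁻ f x = ∫ ξ, planeWave ξ x * f ξ := by
  rw [Real.fourierInv_eq']
  simp only [planeWave, smul_eq_mul]

theorem integrable_planeWave_mul {f : EuclideanSpace ℝ (Fin d) → ℂ} (hf : Integrable f)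
    (v : EuclideanSpace ℝ (Fin d)) : Integrable fun x => planeWave v x * f x :=
  hf.bdd_mul (c := 1) (continuous_planeWave v).aestronglyMeasurable
    (Eventually.of_forall fun x => (norm_planeWave v x).le)

theorem integrable_planeWave_mul' {f : EuclideanSpace ℝ (Fin d) → ℂ} (hf : Integrable f)
    (x : EuclideanSpace ℝ (Fin d)) : Integrable fun v => planeWave v x * f v := by
  refine hf.bdd_mul (c := 1) ?_ (Eventually.of_forall fun v => (norm_planeWave v x).le)
  refine Continuous.aestronglyMeasurable ?_
  unfold planeWave; fun_prop

theorem fourier_sum_planeWave {ι : Type*} [Fintype ι] (c : ι → ℂ)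
    (v : ι → EuclideanSpace ℝ (Fin d)) {f : EuclideanSpace ℝ (Fin d) → ℂ} (hf : Integrable f)
    (ξ : EuclideanSpace ℝ (Fin d)) :
    𝓕 (fun x => ∑ i, c i * (planeWave (v i) x * f x)) ξ = ∑ i, c i * 𝓕 f (ξ - v i) := by
  simp only [fourier_eq_planeWave, Finset.mul_sum]
  rw [integral_finsetSum]
  · refine Finset.sum_congr rfl fun i _ => ?_
    rw [← integral_const_mul]
    congr 1; funext x
    rw [show -(ξ - v i) = -ξ + v i by abel, planeWave_add]; ring
  · intro i _
    exact integrable_planeWave_mul ((integrable_planeWave_mul hf (v i)).const_mul (c i)) (-ξ)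

theorem fourierInv_sum_translate {ι : Type*} [Fintype ι] (c : ι → ℂ)
    (v : ι → EuclideanSpace ℝ (Fin d)) {G : ι → EuclideanSpace ℝ (Fin d) → ℂ}
    (hG : ∀ i, Integrable (G i)) (x : EuclideanSpace ℝ (Fin d)) :
    𝓕⁻ (fun ξ => ∑ i, c i * G i (ξ - v i)) x =
      ∑ i, c i * (planeWave (v i) x * 𝓕⁻ (G i) x) := by
  simp only [fourierInv_eq_planeWave, Finset.mul_sum]
  rw [integral_finsetSum]
  · refine Finset.sum_congr rfl fun i _ => ?_
    rw [← integral_const_mul, ← integral_const_mul,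
      ← integral_add_right_eq_self _ (v i)]
    congr 1; funext ξ
    rw [planeWave_add, add_sub_cancel_right]; ring
  · intro i _
    exact integrable_planeWave_mul' (((hG i).comp_sub_right (v i)).const_mul (c i)) x

theorem continuous_fourierInv {G : EuclideanSpace ℝ (Fin d) → ℂ} (hG : Integrable G) :
    Continuous (𝓕⁻ G) := by
  have : 𝓕⁻ G = fun x => 𝓕 G (-x) := funext fun x => Real.fourierInv_eq_fourier_neg G x
  rw [this]
  exact (VectorFourier.fourierIntegral_continuous Real.continuous_fourierChar
    continuous_inner hG).comp continuous_neg

theorem norm_fourierInv_sub_le {G B : EuclideanSpace ℝ (Fin d) → ℂ} (hG : Integrable G)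
    (hB : Integrable B) (K : ℂ) (x : EuclideanSpace ℝ (Fin d)) :
    ‖𝓕⁻ G x - K * 𝓕⁻ B x‖ ≤ ∫ η, ‖G η - K * B η‖ := by
  rw [fourierInv_eq_planeWave, fourierInv_eq_planeWave, ← integral_const_mul, ← integral_sub
    (integrable_planeWave_mul' hG x) ((integrable_planeWave_mul' hB x).const_mul K)]
  refine (norm_integral_le_integral_norm _).trans (le_of_eq ?_)
  congr 1; funext η
  rw [show planeWave η x * G η - K * (planeWave η x * B η) = planeWave η x * (G η - K * B η) by
    ring, norm_mul, norm_planeWave, one_mul]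

theorem integrable_rpow_mul_norm (B : SchwartzMap (EuclideanSpace ℝ (Fin d)) ℂ) {K s : ℝ}
    (hK : 1 ≤ K) : Integrable fun η => (K + ‖η‖) ^ s * ‖B η‖ := by
  obtain ⟨n, hn⟩ := exists_nat_ge s
  have hint : Integrable fun η => 2 ^ (n - 1) * (K ^ n * ‖B η‖ + ‖η‖ ^ n * ‖B η‖) :=
    ((B.integrable.norm.const_mul (K ^ n)).add (B.integrable_pow_mul volume n)).const_mul _
  refine hint.mono' ?_ (Eventually.of_forall fun η => ?_)
  · refine Continuous.aestronglyMeasurable (Continuous.mul ?_ B.continuous.norm)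
    exact Continuous.rpow_const (by fun_prop) fun η =>
      Or.inl (by linarith [norm_nonneg η] : (0 : ℝ) < K + ‖η‖).ne'
  · have h1 : 1 ≤ K + ‖η‖ := by linarith [norm_nonneg η]
    rw [Real.norm_of_nonneg (by positivity), ← add_mul, ← mul_assoc]
    refine mul_le_mul_of_nonneg_right ?_ (norm_nonneg _)
    calc (K + ‖η‖) ^ s ≤ (K + ‖η‖) ^ (n : ℝ) := Real.rpow_le_rpow_of_exponent_le h1 hn
      _ = (K + ‖η‖) ^ n := Real.rpow_natCast _ _
      _ ≤ _ := add_pow_le (by linarith) (norm_nonneg η) n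

/-- The symbol of `Λ^s` in Mathlib's frequency variable. -/
noncomputable def fracSymbol (s : ℝ) (ξ : EuclideanSpace ℝ (Fin d)) : ℝ :=
  (2 * Real.pi * ‖ξ‖) ^ s

theorem continuous_fracSymbol {s : ℝ} (hs : 0 < s) :
    Continuous (fracSymbol s : EuclideanSpace ℝ (Fin d) → ℝ) :=
  Continuous.rpow_const (by fun_prop) fun _ => Or.inr hs.le

theorem fracSymbol_smul {s r : ℝ} (hr : 0 ≤ r) (ξ : EuclideanSpace ℝ (Fin d)) :
    fracSymbol s (r • ξ) = r ^ s * fracSymbol s ξ := by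
  rw [fracSymbol, fracSymbol, norm_smul, Real.norm_of_nonneg hr, mul_left_comm,
    Real.mul_rpow hr (by positivity)]

theorem fracSymbol_nonneg (s : ℝ) (ξ : EuclideanSpace ℝ (Fin d)) : 0 ≤ fracSymbol s ξ := by
  unfold fracSymbol; positivity

theorem fracSymbol_add_le {s r : ℝ} (hs : 0 < s) (hr : |r| ≤ 1)
    (w η : EuclideanSpace ℝ (Fin d)) :
    fracSymbol s (w + r • η) ≤ (2 * Real.pi) ^ s * ((1 + ‖w‖) + ‖η‖) ^ s := by
  rw [← Real.mul_rpow (by positivity) (by positivity)]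
  refine Real.rpow_le_rpow (by positivity) ?_ hs.le
  refine mul_le_mul_of_nonneg_left ?_ (by positivity)
  have h1 := norm_add_le w (r • η)
  have h2 : ‖r • η‖ ≤ ‖η‖ := by
    rw [norm_smul, Real.norm_eq_abs]; exact mul_le_of_le_one_left (norm_nonneg _) hr
  linarith

theorem integrable_fracSymbol_mul (B : SchwartzMap (EuclideanSpace ℝ (Fin d)) ℂ) {s : ℝ}
    (hs : 0 < s) (w : EuclideanSpace ℝ (Fin d)) :
    Integrable fun η => (fracSymbol s (η + w) : ℂ) * B η := by
  have hint := (integrable_rpow_mul_norm B (s := s)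
    (by linarith [norm_nonneg w] : 1 ≤ 1 + ‖w‖)).const_mul ((2 * Real.pi) ^ s)
  refine hint.mono' ?_ (Eventually.of_forall fun η => ?_)
  · refine Continuous.aestronglyMeasurable (Continuous.mul ?_ B.continuous)
    exact Complex.continuous_ofReal.comp ((continuous_fracSymbol hs).comp (by fun_prop))
  · rw [norm_mul, Complex.norm_real, Real.norm_of_nonneg (fracSymbol_nonneg _ _), ← mul_assoc]
    refine mul_le_mul_of_nonneg_right ?_ (norm_nonneg _)
    have := fracSymbol_add_le (r := 1) hs (by simp) w η
    rwa [one_smul, add_comm w] at this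

/-- The `L¹` distance between the rescaled symbol around frequency `N w` and its value at `w`,
weighted by `B`. -/
noncomputable def symbolDefect (s : ℝ) (B : EuclideanSpace ℝ (Fin d) → ℂ)
    (w : EuclideanSpace ℝ (Fin d)) (N : ℝ) : ℝ :=
  ∫ η, ‖((fracSymbol s (w + N⁻¹ • η) - fracSymbol s w : ℝ) : ℂ) * B η‖

/-- The symbol is continuous at `w` and grows polynomially, while `B` is Schwartz, so dominated
convergence applies. -/
theorem tendsto_symbolDefect {s : ℝ} (hs : 0 < s)
    (B : SchwartzMap (EuclideanSpace ℝ (Fin d)) ℂ) (w : EuclideanSpace ℝ (Fin d)) :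
    Tendsto (symbolDefect s B w) atTop (𝓝 0) := by
  have hint : Integrable fun η => (2 * Real.pi) ^ s * (((1 + ‖w‖) + ‖η‖) ^ s * ‖B η‖) +
      fracSymbol s w * ‖B η‖ :=
    ((integrable_rpow_mul_norm B (by linarith [norm_nonneg w])).const_mul _).add
      (B.integrable.norm.const_mul _)
  have key := tendsto_integral_filter_of_dominated_convergence (μ := volume) (l := atTop)
    (F := fun (N : ℝ) (η : EuclideanSpace ℝ (Fin d)) =>
      ‖((fracSymbol s (w + N⁻¹ • η) - fracSymbol s w : ℝ) : ℂ) * B η‖)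
    (f := fun _ => (0 : ℝ)) _ ?_ ?_ hint ?_
  · rw [integral_zero] at key
    exact key
  · refine Eventually.of_forall fun N => Continuous.aestronglyMeasurable ?_
    refine (Continuous.mul (Complex.continuous_ofReal.comp ?_) B.continuous).norm
    exact ((continuous_fracSymbol hs).comp (by fun_prop)).sub continuous_const
  · filter_upwards [eventually_ge_atTop (1 : ℝ)] with N hN
    refine Eventually.of_forall fun η => ?_
    rw [norm_norm, norm_mul, Complex.norm_real, ← mul_assoc, ← add_mul]
    refine mul_le_mul_of_nonneg_right ((norm_sub_le _ _).trans ?_) (norm_nonneg _)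
    rw [Real.norm_of_nonneg (fracSymbol_nonneg _ _), Real.norm_of_nonneg (fracSymbol_nonneg _ _)]
    refine add_le_add_left (fracSymbol_add_le hs ?_ w η) _
    rw [abs_of_nonneg (by positivity)]
    exact inv_le_one_of_one_le₀ hN
  · refine Eventually.of_forall fun η => ?_
    have h1 : Tendsto (fun N : ℝ => w + N⁻¹ • η) atTop (𝓝 w) := by
      simpa using tendsto_const_nhds.add ((tendsto_inv_atTop_zero (𝕜 := ℝ)).smul_const η)
    have h2 := ((continuous_fracSymbol hs).tendsto w).comp h1
    have h3 : Tendsto (fun N : ℝ => ((fracSymbol s (w + N⁻¹ • η) - fracSymbol s w : ℝ) : ℂ) * B η)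
        atTop (𝓝 (((fracSymbol s w - fracSymbol s w : ℝ) : ℂ) * B η)) :=
      ((Complex.continuous_ofReal.tendsto _).comp (h2.sub_const _)).mul_const _
    simpa using h3.norm

theorem fracLaplacianC_sum_planeWave {s : ℝ} (hs : 0 < s) {ι : Type*} [Fintype ι] (c : ι → ℂ)
    (v : ι → EuclideanSpace ℝ (Fin d)) (φ : SchwartzMap (EuclideanSpace ℝ (Fin d)) ℂ)
    (x : EuclideanSpace ℝ (Fin d)) :
    fracLaplacianC s (fun x => ∑ i, c i * (planeWave (v i) x * φ x)) x =
      ∑ i, c i * (planeWave (v i) x * 𝓕⁻ (fun η => (fracSymbol s (η + v i) : ℂ) * 𝓕 φ η) x) := by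
  rw [← fourierInv_sum_translate c v (fun i => integrable_fracSymbol_mul (𝓕 φ) hs (v i)) x]
  unfold fracLaplacianC
  refine congrFun (congrArg (𝓕⁻ : (EuclideanSpace ℝ (Fin d) → ℂ) → _) (funext fun ξ => ?_)) x
  rw [fourier_sum_planeWave c v φ.integrable, Finset.mul_sum]
  refine Finset.sum_congr rfl fun i _ => ?_
  rw [sub_add_cancel, SchwartzMap.fourier_coe, fracSymbol]
  ring

theorem continuous_fracLaplacianC_sum_planeWave {s : ℝ} (hs : 0 < s) {ι : Type*} [Fintype ι]
    (c : ι → ℂ) (v : ι → EuclideanSpace ℝ (Fin d))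
    (φ : SchwartzMap (EuclideanSpace ℝ (Fin d)) ℂ) :
    Continuous (fracLaplacianC s (fun x => ∑ i, c i * (planeWave (v i) x * φ x))) := by
  have : fracLaplacianC s (fun x => ∑ i, c i * (planeWave (v i) x * φ x)) = fun x =>
      ∑ i, c i * (planeWave (v i) x * 𝓕⁻ (fun η => (fracSymbol s (η + v i) : ℂ) * 𝓕 φ η) x) :=
    funext (fracLaplacianC_sum_planeWave hs c v φ)
  rw [this]
  refine continuous_finsetSum _ fun i _ => continuous_const.mul ((continuous_planeWave _).mul ?_)
  exact continuous_fourierInv (integrable_fracSymbol_mul (𝓕 φ) hs (v i))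

/-- By homogeneity the symbol at `η + N w` is `N^s` times the symbol at `w + η / N`. Freezing the
latter at `w` costs, in sup norm, at most the `L¹` norm of the difference on the Fourier side. -/
theorem norm_fracLaplacianC_sum_planeWave_sub_le {s : ℝ} (hs : 0 < s) {ι : Type*} [Fintype ι]
    (c : ι → ℂ) (w : ι → EuclideanSpace ℝ (Fin d))
    (φ : SchwartzMap (EuclideanSpace ℝ (Fin d)) ℂ) {N : ℝ} (hN : 0 < N)
    (x : EuclideanSpace ℝ (Fin d)) :
    ‖fracLaplacianC s (fun x => ∑ i, c i * (planeWave (N • w i) x * φ x)) x -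
      ∑ i, c i * (planeWave (N • w i) x * (((N ^ s * fracSymbol s (w i) : ℝ) : ℂ) * φ x))‖ ≤
      N ^ s * ∑ i, ‖c i‖ * symbolDefect s (𝓕 (φ : EuclideanSpace ℝ (Fin d) → ℂ)) (w i) N := by
  rw [fracLaplacianC_sum_planeWave hs, ← Finset.sum_sub_distrib, Finset.mul_sum]
  refine (norm_sum_le _ _).trans (Finset.sum_le_sum fun i _ => ?_)
  rw [← mul_sub, ← mul_sub, norm_mul, norm_mul, norm_planeWave, one_mul, mul_left_comm]
  refine mul_le_mul_of_nonneg_left ?_ (norm_nonneg _)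
  have hφ : φ x = 𝓕⁻ (𝓕 (φ : EuclideanSpace ℝ (Fin d) → ℂ)) x := by
    rw [← SchwartzMap.fourier_coe, ← SchwartzMap.fourierInv_coe, FourierTransform.fourierInv_fourier_eq]
  rw [hφ]
  refine (norm_fourierInv_sub_le (integrable_fracSymbol_mul (𝓕 φ) hs _) (𝓕 φ).integrable _ x).trans
    (le_of_eq ?_)
  rw [symbolDefect, ← integral_const_mul]
  congr 1; funext η
  have h1 : η + N • w i = N • (w i + N⁻¹ • η) := by
    rw [smul_add, smul_smul, mul_inv_cancel₀ hN.ne', one_smul, add_comm]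
  have h2 : (0 : ℝ) ≤ N ^ s := by positivity
  rw [SchwartzMap.fourier_coe, h1, fracSymbol_smul hN.le, ← sub_mul, norm_mul, norm_mul, ← Complex.ofReal_sub,
    Complex.norm_real, Complex.norm_real, ← mul_sub, norm_mul, Real.norm_of_nonneg h2, mul_assoc]

end FourierSide

/-! ### Wave packets and their fractional Laplacian -/

section Wave

variable {d : ℕ}

/-- The frequencies of `trigWave`. -/
noncomputable def waveFreq : Fin 4 → ℝ := ![1, -1, 3, -3]

/-- The Fourier coefficients of `θ ↦ trigWave a (θ + τ)`. -/
noncomputable def waveCoeff (a τ : ℝ) : Fin 4 → ℂ :=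
  ![-(Complex.I / 2) * Complex.exp (τ * Complex.I),
    Complex.I / 2 * Complex.exp (-(τ * Complex.I)),
    a * (Complex.I / 2) * Complex.exp (3 * (τ * Complex.I)),
    -(a * (Complex.I / 2)) * Complex.exp (-(3 * (τ * Complex.I)))]

theorem norm_waveCoeff_le (a τ : ℝ) (i : Fin 4) : ‖waveCoeff a τ i‖ ≤ 1 + |a| := by
  have h1 : ∀ t : ℝ, ‖Complex.exp (t * Complex.I)‖ = 1 := Complex.norm_exp_ofReal_mul_I
  have e1 : ‖Complex.exp (-(τ * Complex.I))‖ = 1 := by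
    simpa [neg_mul] using h1 (-τ)
  have e2 : ‖Complex.exp (3 * (τ * Complex.I))‖ = 1 := by
    simpa [mul_assoc] using h1 (3 * τ)
  have e3 : ‖Complex.exp (-(3 * (τ * Complex.I)))‖ = 1 := by
    simpa [mul_assoc, neg_mul] using h1 (-(3 * τ))
  have := abs_nonneg a
  fin_cases i <;> simp [waveCoeff, h1, e1, e2, e3] <;> linarith

theorem trigWave_eq_sum (a N τ : ℝ) (e x : EuclideanSpace ℝ (Fin d)) :
    ((trigWave a (2 * Real.pi * N * inner ℝ e x + τ) : ℝ) : ℂ) =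
      ∑ i, waveCoeff a τ i * planeWave (N • (waveFreq i • e)) x := by
  have hw : ∀ k : ℝ, planeWave (N • (k • e)) x =
      Complex.exp (k * (((2 * Real.pi * N * inner ℝ e x : ℝ) : ℂ) * Complex.I)) := by
    intro k
    rw [planeWave, real_inner_smul_left, real_inner_smul_left]
    congr 1; push_cast; ring
  generalize 2 * Real.pi * N * inner ℝ e x = z at hw ⊢
  rw [Fin.sum_univ_four, hw, hw, hw, hw]
  simp only [trigWave, waveCoeff, waveFreq, Matrix.cons_val, mul_assoc, ← Complex.exp_add]
  push_cast
  rw [Complex.sin, Complex.sin,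
    show -((z : ℂ) + τ) * Complex.I = -(τ * Complex.I) + -1 * (z * Complex.I) by ring,
    show ((z : ℂ) + τ) * Complex.I = τ * Complex.I + 1 * (z * Complex.I) by ring,
    show -(3 * ((z : ℂ) + τ)) * Complex.I = -(3 * (τ * Complex.I)) + -3 * (z * Complex.I) by ring,
    show 3 * ((z : ℂ) + τ) * Complex.I = 3 * (τ * Complex.I) + 3 * (z * Complex.I) by ring]
  ring

/-- The frequencies have length `1` or `3`, so apart from the common factor `(2π)^s` only the third
harmonic is rescaled, by `3^s`. -/
theorem waveCoeff_mul_fracSymbol (s a τ : ℝ) {e : EuclideanSpace ℝ (Fin d)} (he : ‖e‖ = 1)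
    (i : Fin 4) :
    waveCoeff a τ i * (fracSymbol s (waveFreq i • e) : ℂ) =
      ((2 * Real.pi) ^ s : ℝ) * waveCoeff (a * 3 ^ s) τ i := by
  have h3 : (2 * Real.pi * 3) ^ s = (2 * Real.pi) ^ s * 3 ^ s :=
    Real.mul_rpow (by positivity) (by norm_num)
  fin_cases i <;> simp [waveCoeff, waveFreq, fracSymbol, norm_smul, he, h3] <;> ring

/-- The wave packet `x ↦ trigWave a (2πN⟨e, x⟩ + τ) φ(x)`. -/
noncomputable def wavePacket (a N τ : ℝ) (e : EuclideanSpace ℝ (Fin d))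
    (φ : EuclideanSpace ℝ (Fin d) → ℝ) (x : EuclideanSpace ℝ (Fin d)) : ℝ :=
  trigWave a (2 * Real.pi * N * inner ℝ e x + τ) * φ x

theorem ofReal_wavePacket (a N τ : ℝ) (e : EuclideanSpace ℝ (Fin d))
    (φ : EuclideanSpace ℝ (Fin d) → ℝ) (x : EuclideanSpace ℝ (Fin d)) :
    ((wavePacket a N τ e φ x : ℝ) : ℂ) =
      ∑ i, waveCoeff a τ i * (planeWave (N • (waveFreq i • e)) x * (φ x : ℂ)) := by
  rw [wavePacket, Complex.ofReal_mul, trigWave_eq_sum, Finset.sum_mul]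
  simp only [mul_assoc]

/-- The complexification of a real Schwartz function. -/
noncomputable def schwartzOfReal (φ : SchwartzMap (EuclideanSpace ℝ (Fin d)) ℝ) :
    SchwartzMap (EuclideanSpace ℝ (Fin d)) ℂ :=
  φ.postcompCLM Complex.ofRealCLM

theorem schwartzOfReal_apply (φ : SchwartzMap (EuclideanSpace ℝ (Fin d)) ℝ)
    (x : EuclideanSpace ℝ (Fin d)) : schwartzOfReal φ x = (φ x : ℂ) := rfl

theorem ofReal_wavePacket' (a N τ : ℝ) (e : EuclideanSpace ℝ (Fin d))
    (φ : SchwartzMap (EuclideanSpace ℝ (Fin d)) ℝ) :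
    (fun x => ((wavePacket a N τ e φ x : ℝ) : ℂ)) = fun x =>
      ∑ i, waveCoeff a τ i * (planeWave (N • (waveFreq i • e)) x * schwartzOfReal φ x) :=
  funext fun x => ofReal_wavePacket a N τ e φ x

theorem continuous_fracLaplacian_wavePacket {s : ℝ} (hs : 0 < s) (a N τ : ℝ)
    (e : EuclideanSpace ℝ (Fin d)) (φ : SchwartzMap (EuclideanSpace ℝ (Fin d)) ℝ) :
    Continuous (fracLaplacian s (wavePacket a N τ e φ)) := by
  unfold fracLaplacian
  rw [ofReal_wavePacket']
  exact Complex.continuous_re.comp (continuous_fracLaplacianC_sum_planeWave hs _ _ _)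

/-- Away from low frequencies, `Λ^s` acts on a wave packet through its carrier wave only. -/
theorem exists_tendsto_abs_fracLaplacian_wavePacket_sub_le {s : ℝ} (hs : 0 < s) (a : ℝ)
    {e : EuclideanSpace ℝ (Fin d)} (he : ‖e‖ = 1)
    (φ : SchwartzMap (EuclideanSpace ℝ (Fin d)) ℝ) :
    ∃ δ : ℝ → ℝ, Tendsto δ atTop (𝓝 0) ∧ ∀ N, 0 < N → ∀ τ x,
      |fracLaplacian s (wavePacket a N τ e φ) x -
        N ^ s * ((2 * Real.pi) ^ s * wavePacket (a * 3 ^ s) N τ e φ x)| ≤ N ^ s * δ N := by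
  -- The coefficient bound `1 + |a|` makes the error independent of `τ`, which matters because the
  -- phase is chosen later, depending on `N`.
  refine ⟨fun N => ∑ i, (1 + |a|) * symbolDefect s
    (𝓕 (schwartzOfReal φ : EuclideanSpace ℝ (Fin d) → ℂ)) (waveFreq i • e) N, ?_, ?_⟩
  · have : Tendsto (fun N => ∑ i, (1 + |a|) * symbolDefect s
        (𝓕 (schwartzOfReal φ : EuclideanSpace ℝ (Fin d) → ℂ)) (waveFreq i • e) N) atTop
        (𝓝 (∑ i : Fin 4, (1 + |a|) * 0)) :=
      tendsto_finsetSum _ fun i _ => (tendsto_symbolDefect hs (𝓕 (schwartzOfReal φ)) _).const_mul _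
    simpa using this
  · intro N hN τ x
    have key := norm_fracLaplacianC_sum_planeWave_sub_le hs (waveCoeff a τ)
      (fun i => waveFreq i • e) (schwartzOfReal φ) hN x
    have hsum : ∑ i, waveCoeff a τ i * (planeWave (N • (waveFreq i • e)) x *
        (((N ^ s * fracSymbol s (waveFreq i • e) : ℝ) : ℂ) * schwartzOfReal φ x)) =
        ((N ^ s * ((2 * Real.pi) ^ s * wavePacket (a * 3 ^ s) N τ e φ x) : ℝ) : ℂ) := by
      rw [Complex.ofReal_mul, Complex.ofReal_mul, ofReal_wavePacket, Finset.mul_sum,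
        Finset.mul_sum]
      refine Finset.sum_congr rfl fun i _ => ?_
      have := waveCoeff_mul_fracSymbol s a τ he i
      rw [schwartzOfReal_apply, Complex.ofReal_mul]
      linear_combination (planeWave (N • (waveFreq i • e)) x * ((N ^ s : ℝ) : ℂ) * φ x) * this
    rw [hsum, ← ofReal_wavePacket', ← ofReal_fracLaplacian, ← Complex.ofReal_sub,
      Complex.norm_real, Real.norm_eq_abs] at key
    refine key.trans (mul_le_mul_of_nonneg_left (Finset.sum_le_sum fun i _ => ?_) (by positivity))
    refine mul_le_mul_of_nonneg_right (norm_waveCoeff_le a τ i) ?_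
    exact integral_nonneg fun _ => norm_nonneg _

end Wave

/-! ### Phase averaging and negativity of the form -/

section Negativity

variable {d : ℕ}

theorem SchwartzMap.integrable_abs_rpow (φ : SchwartzMap (EuclideanSpace ℝ (Fin d)) ℝ) {q : ℝ}
    (hq : 0 < q) : Integrable fun x => |φ x| ^ q := by
  have := (φ.memLp (ENNReal.ofReal q)).integrable_norm_rpow (by simpa using hq)
    ENNReal.ofReal_ne_top
  simpa [ENNReal.toReal_ofReal hq.le] using this

theorem integral_abs_rpow_pos {f : EuclideanSpace ℝ (Fin d) → ℝ} (hf : Continuous f) {q : ℝ}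
    (hq : 0 < q) (hint : Integrable fun x => |f x| ^ q) (hne : ∃ x, f x ≠ 0) :
    0 < ∫ x, |f x| ^ q := by
  obtain ⟨x, hx⟩ := hne
  refine integral_pos_of_integrable_nonneg_nonzero (x := x) ?_ hint (fun y => by positivity)
    (Real.rpow_pos_of_pos (abs_pos.mpr hx) q).ne'
  exact hf.abs.rpow_const fun _ => Or.inr hq.le

theorem integrable_waveDensity_mul {a b p : ℝ} (hp : 1 < p) {ψ : EuclideanSpace ℝ (Fin d) → ℝ}
    (hψ : Integrable ψ) {z : EuclideanSpace ℝ (Fin d) → ℝ} (hz : Measurable z) :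
    Integrable fun x => waveDensity a b p (z x) * ψ x :=
  hψ.bdd_mul ((measurable_waveDensity a b p).comp hz).aestronglyMeasurable
    (Eventually.of_forall fun x => abs_waveDensity_le a b hp (z x))

/-- Some phase shift does at least as well as the mean over all phases. -/
theorem exists_integral_waveDensity_mul_le {a b p : ℝ} (hp : 1 < p)
    {ψ : EuclideanSpace ℝ (Fin d) → ℝ} (hψ : Integrable ψ) {z : EuclideanSpace ℝ (Fin d) → ℝ}
    (hz : Measurable z) :
    ∃ τ : ℝ, ∫ x, waveDensity a b p (z x + τ) * ψ x ≤
      Real.pi⁻¹ * ((∫ θ in (0 : ℝ)..Real.pi, waveDensity a b p θ) * ∫ x, ψ x) := by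
  set ν : Measure ℝ := volume.restrict (Set.Ioc 0 Real.pi) with hν
  have hprod : Integrable (Function.uncurry fun (τ : ℝ) (x : EuclideanSpace ℝ (Fin d)) =>
      waveDensity a b p (z x + τ) * ψ x) (ν.prod volume) := by
    have h1 : Integrable (fun y : ℝ × EuclideanSpace ℝ (Fin d) => (1 : ℝ) * ψ y.2)
        (ν.prod volume) := Integrable.mul_prod (integrable_const 1) hψ
    simp only [one_mul] at h1
    refine h1.bdd_mul (c := (1 + |b|) * (1 + |a|) ^ (p - 1)) ?_
      (Eventually.of_forall fun y => abs_waveDensity_le a b hp _)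
    refine ((measurable_waveDensity a b p).comp ?_).aestronglyMeasurable
    exact (hz.comp measurable_snd).add measurable_fst
  obtain ⟨τ, -, hτ⟩ := exists_le_setAverage (μ := (volume : Measure ℝ)) (s := Set.Ioc 0 Real.pi)
    (by simp [Real.pi_pos]) (by simp) hprod.integral_prod_left
  refine ⟨τ, hτ.trans (le_of_eq ?_)⟩
  rw [setAverage_eq]
  simp only [Function.uncurry_apply_pair]
  rw [integral_integral_swap hprod]
  -- The phase runs over a full period of the density, so the shift by `z x` disappears and the two
  -- factors decouple.
  have hinner : ∀ x, ∫ τ, waveDensity a b p (z x + τ) * ψ x ∂ν =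
      (∫ θ in (0 : ℝ)..Real.pi, waveDensity a b p θ) * ψ x := by
    intro x
    rw [integral_mul_const, hν, ← intervalIntegral.integral_of_le Real.pi_pos.le,
      intervalIntegral.integral_comp_add_left (waveDensity a b p), add_zero,
      (waveDensity_periodic a b p).intervalIntegral_add_eq (z x) 0, zero_add]
  simp only [hinner, integral_const_mul, smul_eq_mul]
  simp [Real.pi_pos.le]

/-- The signed power is multiplicative, so the carrier term splits into a wave density times
`|φ|^p`. The error is paired with a signed power of size at most a constant times `|φ|^(p-1)`, which
is integrable since `p > 1`. -/
theorem bernsteinForm_wavePacket_le {s p a δ N : ℝ} (hs : 0 < s) (hp : 1 < p)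
    (e : EuclideanSpace ℝ (Fin d)) (φ : SchwartzMap (EuclideanSpace ℝ (Fin d)) ℝ) (τ : ℝ)
    (hδ : ∀ x, |fracLaplacian s (wavePacket a N τ e φ) x -
        N ^ s * ((2 * Real.pi) ^ s * wavePacket (a * 3 ^ s) N τ e φ x)| ≤ N ^ s * δ) :
    bernsteinForm s p (wavePacket a N τ e φ) ≤ N ^ s *
      ((2 * Real.pi) ^ s * (∫ x, waveDensity a (a * 3 ^ s) p (2 * Real.pi * N * inner ℝ e x + τ) *
        |φ x| ^ p) + δ * ((1 + |a|) ^ (p - 1) * ∫ x, |φ x| ^ (p - 1))) := by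
  set D : EuclideanSpace ℝ (Fin d) → ℝ := fun x =>
    waveDensity a (a * 3 ^ s) p (2 * Real.pi * N * inner ℝ e x + τ) * |φ x| ^ p with hD
  have hDint : Integrable D := integrable_waveDensity_mul hp
    (φ.integrable_abs_rpow (by linarith)) (Continuous.measurable (by fun_prop))
  have hφint := φ.integrable_abs_rpow (by linarith : 0 < p - 1)
  set F : EuclideanSpace ℝ (Fin d) → ℝ := wavePacket a N τ e φ with hF
  set R : EuclideanSpace ℝ (Fin d) → ℝ := fun x => N ^ s * δ *
    ((1 + |a|) ^ (p - 1) * |φ x| ^ (p - 1)) with hR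
  have hRint : Integrable R := (hφint.const_mul _).const_mul _
  have hclose : ∀ x, |fracLaplacian s F x * signedPow p (F x) - N ^ s * (2 * Real.pi) ^ s * D x| ≤
      R x := by
    intro x
    have hsplit : fracLaplacian s F x * signedPow p (F x) - N ^ s * (2 * Real.pi) ^ s * D x =
        (fracLaplacian s F x - N ^ s * ((2 * Real.pi) ^ s * wavePacket (a * 3 ^ s) N τ e φ x)) *
          signedPow p (F x) := by
      simp only [hD, hF, wavePacket, signedPow_mul, waveDensity, ← mul_signedPow hp]
      ring
    rw [hsplit, abs_mul]
    refine mul_le_mul (hδ x) ?_ (abs_nonneg _) ((abs_nonneg _).trans (hδ x))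
    rw [hF, wavePacket, signedPow_mul, abs_mul, abs_signedPow hp (φ x)]
    exact mul_le_mul_of_nonneg_right (abs_signedPow_trigWave_le a hp _) (by positivity)
  have hFcont : Continuous F :=
    ((continuous_trigWave a).comp (by fun_prop)).mul φ.continuous
  have hmeas : AEStronglyMeasurable (fun x => fracLaplacian s F x * signedPow p (F x) -
      N ^ s * (2 * Real.pi) ^ s * D x) volume :=
    ((continuous_fracLaplacian_wavePacket hs a N τ e φ).measurable.mul
      ((measurable_signedPow p).comp hFcont.measurable)).aestronglyMeasurable.sub
      (hDint.const_mul _).aestronglyMeasurable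
  have hdiff := hRint.mono' hmeas (Eventually.of_forall hclose)
  have hform : Integrable fun x => fracLaplacian s F x * signedPow p (F x) := by
    refine (hdiff.add (hDint.const_mul (N ^ s * (2 * Real.pi) ^ s))).congr
      (Eventually.of_forall fun x => ?_)
    simp
  calc bernsteinForm s p F = ∫ x, fracLaplacian s F x * signedPow p (F x) := rfl
    _ ≤ ∫ x, (N ^ s * (2 * Real.pi) ^ s * D x + R x) := by
        refine integral_mono hform ((hDint.const_mul _).add hRint) fun x => ?_
        have := (abs_le.mp (hclose x)).2
        dsimp only
        linarith
    _ = _ := by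
        rw [integral_add (hDint.const_mul _) hRint, integral_const_mul, hR, integral_const_mul,
          integral_const_mul]
        ring

theorem eventually_exists_bernsteinForm_wavePacket_neg {s p a : ℝ} (hs : 0 < s) (hp : 1 < p)
    (hneg : ∫ θ in (0 : ℝ)..Real.pi, waveDensity a (a * 3 ^ s) p θ < 0)
    {e : EuclideanSpace ℝ (Fin d)} (he : ‖e‖ = 1)
    (φ : SchwartzMap (EuclideanSpace ℝ (Fin d)) ℝ) (hφ : ∃ x, φ x ≠ 0) :
    ∀ᶠ N : ℝ in atTop, ∃ τ : ℝ, bernsteinForm s p (wavePacket a N τ e φ) < 0 := by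
  obtain ⟨δ, hδ0, hδ⟩ := exists_tendsto_abs_fracLaplacian_wavePacket_sub_le hs a he φ
  have hφp := φ.integrable_abs_rpow (by linarith : 0 < p)
  have hpos := integral_abs_rpow_pos φ.continuous (by linarith : 0 < p) hφp hφ
  set J := Real.pi⁻¹ * ((∫ θ in (0 : ℝ)..Real.pi, waveDensity a (a * 3 ^ s) p θ) *
    ∫ x, |φ x| ^ p) with hJ
  have hJneg : J < 0 := mul_neg_of_pos_of_neg (by positivity) (mul_neg_of_neg_of_pos hneg hpos)
  set K := (1 + |a|) ^ (p - 1) * ∫ x, |φ x| ^ (p - 1) with hK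
  have hlim : Tendsto (fun N => (2 * Real.pi) ^ s * J + δ N * K) atTop
      (𝓝 ((2 * Real.pi) ^ s * J + 0 * K)) := (hδ0.mul_const K).const_add _
  rw [zero_mul, add_zero] at hlim
  have hlt : (2 * Real.pi) ^ s * J < 0 := mul_neg_of_pos_of_neg (by positivity) hJneg
  filter_upwards [hlim.eventually (gt_mem_nhds hlt), eventually_gt_atTop 0] with N h1 hN
  obtain ⟨τ, hτ⟩ := exists_integral_waveDensity_mul_le (a := a) (b := a * 3 ^ s) hp hφp
    (z := fun x => 2 * Real.pi * N * inner ℝ e x) (Continuous.measurable (by fun_prop))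
  refine ⟨τ, (bernsteinForm_wavePacket_le hs hp e φ τ (hδ N hN τ)).trans_lt ?_⟩
  refine mul_neg_of_pos_of_neg (by positivity) (lt_of_le_of_lt ?_ h1)
  exact add_le_add_left (mul_le_mul_of_nonneg_left hτ (by positivity)) _

end Negativity

/-! ### Dilations -/

section Scaling

variable {d : ℕ}

theorem planeWave_smul_right (M : ℝ) (v x : EuclideanSpace ℝ (Fin d)) :
    planeWave v (M • x) = planeWave (M • v) x := by
  rw [planeWave, planeWave, real_inner_smul_left, real_inner_smul_right]

theorem fourier_comp_smul {M : ℝ} (hM : 0 < M) (f : EuclideanSpace ℝ (Fin d) → ℂ)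
    (ξ : EuclideanSpace ℝ (Fin d)) :
    𝓕 (fun x => f (M • x)) ξ = ((M ^ d)⁻¹ : ℝ) * 𝓕 f (M⁻¹ • ξ) := by
  have h := Measure.integral_comp_smul (volume : Measure (EuclideanSpace ℝ (Fin d)))
    (fun x => planeWave (-(M⁻¹ • ξ)) x * f x) M
  rw [finrank_euclideanSpace_fin, abs_of_pos (by positivity), Complex.real_smul] at h
  rw [fourier_eq_planeWave, fourier_eq_planeWave, ← h]
  simp only [planeWave_smul_right, smul_neg, smul_smul, mul_inv_cancel₀ hM.ne', one_smul]

theorem fourierInv_comp_inv_smul {M : ℝ} (hM : 0 < M) (G : EuclideanSpace ℝ (Fin d) → ℂ)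
    (x : EuclideanSpace ℝ (Fin d)) :
    𝓕⁻ (fun ξ => G (M⁻¹ • ξ)) x = (M ^ d : ℝ) * 𝓕⁻ G (M • x) := by
  have h := Measure.integral_comp_inv_smul (volume : Measure (EuclideanSpace ℝ (Fin d)))
    (fun ξ => planeWave ξ (M • x) * G ξ) M
  rw [finrank_euclideanSpace_fin, abs_of_pos (by positivity), Complex.real_smul] at h
  rw [fourierInv_eq_planeWave, fourierInv_eq_planeWave, ← h]
  simp only [planeWave_smul_right, smul_smul, mul_inv_cancel₀ hM.ne', one_smul]

theorem fourierInv_const_mul (c : ℂ) (G : EuclideanSpace ℝ (Fin d) → ℂ)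
    (x : EuclideanSpace ℝ (Fin d)) : 𝓕⁻ (fun ξ => c * G ξ) x = c * 𝓕⁻ G x := by
  rw [fourierInv_eq_planeWave, fourierInv_eq_planeWave, ← integral_const_mul]
  congr 1; funext ξ; ring

theorem fracLaplacianC_comp_smul (s : ℝ) {M : ℝ} (hM : 0 < M)
    (f : EuclideanSpace ℝ (Fin d) → ℂ) (x : EuclideanSpace ℝ (Fin d)) :
    fracLaplacianC s (fun x => f (M • x)) x = (M ^ s : ℝ) * fracLaplacianC s f (M • x) := by
  set G : EuclideanSpace ℝ (Fin d) → ℂ := fun η => (((2 * Real.pi * ‖η‖) ^ s : ℝ) : ℂ) * 𝓕 f η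
  have hG : (fun ξ : EuclideanSpace ℝ (Fin d) =>
      (((2 * Real.pi * ‖ξ‖) ^ s : ℝ) : ℂ) * 𝓕 (fun x => f (M • x)) ξ) =
      fun ξ => (((M ^ d)⁻¹ * M ^ s : ℝ) : ℂ) * G (M⁻¹ • ξ) := by
    funext ξ
    have h1 : (2 * Real.pi * ‖ξ‖) ^ s = M ^ s * (2 * Real.pi * ‖M⁻¹ • ξ‖) ^ s := by
      have := fracSymbol_smul (s := s) hM.le (M⁻¹ • ξ)
      rwa [smul_smul, mul_inv_cancel₀ hM.ne', one_smul, fracSymbol, fracSymbol] at this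
    rw [fourier_comp_smul hM, h1]
    simp only [G]
    push_cast
    ring
  change 𝓕⁻ (fun ξ : EuclideanSpace ℝ (Fin d) =>
    (((2 * Real.pi * ‖ξ‖) ^ s : ℝ) : ℂ) * 𝓕 (fun x => f (M • x)) ξ) x = (M ^ s : ℝ) * 𝓕⁻ G (M • x)
  rw [hG, fourierInv_const_mul ((((M ^ d)⁻¹ * M ^ s : ℝ) : ℂ)) (fun ξ => G (M⁻¹ • ξ)),
    fourierInv_comp_inv_smul hM, ← mul_assoc, ← Complex.ofReal_mul,
    show (M ^ d)⁻¹ * M ^ s * M ^ d = M ^ s by field_simp]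

theorem fracLaplacian_comp_smul (s : ℝ) {M : ℝ} (hM : 0 < M)
    (f : EuclideanSpace ℝ (Fin d) → ℝ) (x : EuclideanSpace ℝ (Fin d)) :
    fracLaplacian s (fun x => f (M • x)) x = M ^ s * fracLaplacian s f (M • x) := by
  unfold fracLaplacian
  rw [fracLaplacianC_comp_smul s hM (fun y => (f y : ℂ)), Complex.re_ofReal_mul]

theorem bernsteinForm_comp_smul (s p : ℝ) {M : ℝ} (hM : 0 < M)
    (f : EuclideanSpace ℝ (Fin d) → ℝ) :
    bernsteinForm s p (fun x => f (M • x)) = M ^ s * ((M ^ d)⁻¹ * bernsteinForm s p f) := by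
  have h := Measure.integral_comp_smul (volume : Measure (EuclideanSpace ℝ (Fin d)))
    (fun x => fracLaplacian s f x * (|f x| ^ (p - 2) * f x)) M
  rw [finrank_euclideanSpace_fin, abs_of_pos (by positivity), smul_eq_mul] at h
  rw [bernsteinForm, bernsteinForm, ← h, ← integral_const_mul]
  simp only [fracLaplacian_comp_smul s hM, mul_assoc]

/-- Both integrals carry the Jacobian `M^(-d)`, and homogeneity of `Λ^s` supplies the remaining
`M^s`. One negative packet therefore yields a whole sequence with the same ratio. -/
theorem bernsteinForm_comp_smul_div (s p : ℝ) {M : ℝ} (hM : 0 < M)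
    (f : EuclideanSpace ℝ (Fin d) → ℝ) :
    bernsteinForm s p (fun x => f (M • x)) / (M ^ s * ∫ x, |f (M • x)| ^ p) =
      bernsteinForm s p f / ∫ x, |f x| ^ p := by
  have h := Measure.integral_comp_smul (volume : Measure (EuclideanSpace ℝ (Fin d)))
    (fun x => |f x| ^ p) M
  rw [finrank_euclideanSpace_fin, abs_of_pos (by positivity), smul_eq_mul] at h
  rw [bernsteinForm_comp_smul s p hM, h, mul_div_mul_left _ _ (by positivity),
    mul_div_mul_left _ _ (by positivity)]

end Scaling

/-! ### Schwartz regularity and Fourier support of packets -/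

section Packets

variable {d : ℕ}

theorem exists_schwartzMap_eq_comp_smul (f : SchwartzMap (EuclideanSpace ℝ (Fin d)) ℝ) {M : ℝ}
    (hM : 0 < M) : ∃ g : SchwartzMap (EuclideanSpace ℝ (Fin d)) ℝ, ⇑g = fun x => f (M • x) :=
  ⟨f.compCLMOfContinuousLinearEquiv ℝ (ContinuousLinearEquiv.smulLeft (Units.mk0 M hM.ne')), rfl⟩

theorem exists_schwartzMap_eq_wavePacket (a N τ : ℝ) (e : EuclideanSpace ℝ (Fin d))
    (φ : SchwartzMap (EuclideanSpace ℝ (Fin d)) ℝ) :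
    ∃ f : SchwartzMap (EuclideanSpace ℝ (Fin d)) ℝ, ⇑f = wavePacket a N τ e φ := by
  set B : SchwartzMap (EuclideanSpace ℝ (Fin d)) ℂ := 𝓕 (schwartzOfReal φ) with hB
  -- Modulations of `φ` are built as translates on the Fourier side, so Schwartz decay needs no
  -- estimate.
  set F : SchwartzMap (EuclideanSpace ℝ (Fin d)) ℂ := 𝓕⁻ (∑ i, waveCoeff a τ i •
    SchwartzMap.compSubConstCLM ℂ (N • (waveFreq i • e)) B) with hF
  refine ⟨F.postcompCLM Complex.reCLM, funext fun x => ?_⟩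
  have hFx : F x = ((wavePacket a N τ e φ x : ℝ) : ℂ) := by
    have hinv : 𝓕⁻ (⇑B) x = (φ x : ℂ) := by
      rw [← SchwartzMap.fourierInv_coe, hB, FourierTransform.fourierInv_fourier_eq,
        schwartzOfReal_apply]
    have hsum := fourierInv_sum_translate (waveCoeff a τ) (fun i => N • (waveFreq i • e))
      (G := fun _ => B) (fun _ => B.integrable) x
    rw [ofReal_wavePacket, hF, SchwartzMap.fourierInv_coe]
    simp only [hinv] at hsum
    rw [← hsum]
    refine congrFun (congrArg (𝓕⁻ : (EuclideanSpace ℝ (Fin d) → ℂ) → _) (funext fun ξ => ?_)) x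
    simp
  rw [SchwartzMap.postcompCLM_apply, hFx]
  simp

theorem fourier_wavePacket (a N τ : ℝ) (e : EuclideanSpace ℝ (Fin d))
    (φ : SchwartzMap (EuclideanSpace ℝ (Fin d)) ℝ) (ξ : EuclideanSpace ℝ (Fin d)) :
    𝓕 (fun x => ((wavePacket a N τ e φ x : ℝ) : ℂ)) ξ =
      ∑ i, waveCoeff a τ i * 𝓕 (schwartzOfReal φ : EuclideanSpace ℝ (Fin d) → ℂ)
        (ξ - N • (waveFreq i • e)) := by
  rw [ofReal_wavePacket']
  exact fourier_sum_planeWave _ _ (schwartzOfReal φ).integrable ξ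

/-- The spectrum lies in unit balls around four centres of length `N` or `3N`. -/
theorem fourier_wavePacket_eq_zero {a N τ : ℝ} {e : EuclideanSpace ℝ (Fin d)} (he : ‖e‖ = 1)
    {φ : SchwartzMap (EuclideanSpace ℝ (Fin d)) ℝ}
    (hφ : ∀ ξ, 1 ≤ ‖ξ‖ → 𝓕 (schwartzOfReal φ : EuclideanSpace ℝ (Fin d) → ℂ) ξ = 0)
    (hN : 0 < N) {ξ : EuclideanSpace ℝ (Fin d)} (hξ : ‖ξ‖ < N - 1 ∨ 3 * N + 1 < ‖ξ‖) :
    𝓕 (fun x => ((wavePacket a N τ e φ x : ℝ) : ℂ)) ξ = 0 := by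
  rw [fourier_wavePacket]
  refine Finset.sum_eq_zero fun i _ => ?_
  rw [hφ, mul_zero]
  have hk : N ≤ ‖N • (waveFreq i • e)‖ ∧ ‖N • (waveFreq i • e)‖ ≤ 3 * N := by
    rw [norm_smul, norm_smul, he, mul_one, Real.norm_of_nonneg hN.le]
    have hfreq : 1 ≤ ‖waveFreq i‖ ∧ ‖waveFreq i‖ ≤ 3 := by
      fin_cases i <;> norm_num [waveFreq]
    constructor <;> nlinarith [hfreq.1, hfreq.2]
  have h1 := norm_sub_norm_le ξ (N • (waveFreq i • e))
  have h2 := norm_sub_norm_le (N • (waveFreq i • e)) ξ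
  rw [norm_sub_rev] at h2
  rcases hξ with h | h <;> linarith [hk.1, hk.2]

theorem tsupport_fourier_comp_smul_wavePacket_subset {a N τ M : ℝ}
    {e : EuclideanSpace ℝ (Fin d)} (he : ‖e‖ = 1)
    {φ : SchwartzMap (EuclideanSpace ℝ (Fin d)) ℝ}
    (hφ : ∀ ξ, 1 ≤ ‖ξ‖ → 𝓕 (schwartzOfReal φ : EuclideanSpace ℝ (Fin d) → ℂ) ξ = 0)
    (hN : 0 < N) (hM : 0 < M) {f : EuclideanSpace ℝ (Fin d) → ℝ}
    (hf : f = wavePacket a N τ e φ) :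
    tsupport (𝓕 (fun x : EuclideanSpace ℝ (Fin d) => ((f (M • x) : ℝ) : ℂ))) ⊆
      {ξ | M * (N - 1) ≤ ‖ξ‖ ∧ ‖ξ‖ ≤ M * (3 * N + 1)} := by
  refine closure_minimal (fun ξ hξ => ?_) ((isClosed_le continuous_const continuous_norm).inter
    (isClosed_le continuous_norm continuous_const))
  by_contra hout
  refine hξ ?_
  rw [fourier_comp_smul hM (fun x => ((f x : ℝ) : ℂ)), hf,
    fourier_wavePacket_eq_zero he hφ hN, mul_zero]
  rw [norm_smul, norm_inv, Real.norm_of_nonneg hM.le, inv_mul_lt_iff₀ hM, lt_inv_mul_iff₀ hM]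
  by_contra! h
  exact hout h

/-- Take the inverse Fourier transform of a bump supported in the unit ball; it is real because the
bump is real and even. -/
theorem exists_schwartzMap_fourier_eq_zero (d : ℕ) :
    ∃ φ : SchwartzMap (EuclideanSpace ℝ (Fin d)) ℝ, (∃ x, φ x ≠ 0) ∧
      ∀ ξ, 1 ≤ ‖ξ‖ → 𝓕 (schwartzOfReal φ : EuclideanSpace ℝ (Fin d) → ℂ) ξ = 0 := by
  let b : ContDiffBump (0 : EuclideanSpace ℝ (Fin d)) := ⟨1 / 2, 1, by norm_num, by norm_num⟩
  set B : SchwartzMap (EuclideanSpace ℝ (Fin d)) ℂ :=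
    schwartzOfReal (b.hasCompactSupport.toSchwartzMap b.contDiff) with hB
  have hBx : ∀ x, B x = (b x : ℂ) := fun x => rfl
  set φ : SchwartzMap (EuclideanSpace ℝ (Fin d)) ℝ :=
    (𝓕⁻ B).postcompCLM Complex.reCLM with hφ
  have hreal : ∀ x, (φ x : ℂ) = (𝓕⁻ B) x := by
    intro x
    have hconj : (starRingEnd ℂ) ((𝓕⁻ B) x) = (𝓕⁻ B) x := by
      rw [SchwartzMap.fourierInv_coe, Real.fourierInv_eq', ← integral_conj,
        ← integral_neg_eq_self]
      congr 1; funext v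
      simp [← Complex.exp_conj, Complex.conj_ofNat, hBx, b.neg]
    exact Complex.conj_eq_iff_re.mp hconj
  have hC : schwartzOfReal φ = 𝓕⁻ B := SchwartzMap.ext hreal
  have hfour : 𝓕 (schwartzOfReal φ : EuclideanSpace ℝ (Fin d) → ℂ) = B := by
    rw [← SchwartzMap.fourier_coe, hC, FourierTransform.fourier_fourierInv_eq]
  refine ⟨φ, ?_, fun ξ hξ => ?_⟩
  · by_contra! hzero
    have h0 : schwartzOfReal φ = 0 := SchwartzMap.ext fun x => by
      rw [schwartzOfReal_apply, hzero x]; simp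
    have h1 : B = 0 := by
      rw [← FourierTransform.fourier_fourierInv_eq (F := SchwartzMap (EuclideanSpace ℝ (Fin d)) ℂ) B,
        ← hC, h0]
      exact FourierTransform.fourier_zero
    have h2 : (b 0 : ℂ) = 0 := by rw [← hBx, h1]; rfl
    rw [b.one_of_mem_closedBall (by simp [b.rIn_pos.le])] at h2
    simp at h2
  · rw [hfour, hBx, b.zero_of_le_dist (by simpa [b] using hξ)]
    simp

end Packets

/-! ### The theorem -/

theorem theorem3p3 (d : ℕ) (hd : 1 ≤ d) (s : ℝ) (hs : 2 < s) :
    ∃ p₁ : ℝ, 1 < p₁ ∧ p₁ < 2 ∧ ∀ p : ℝ, 1 < p → p ≤ p₁ →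
      (∃ C : ℝ, 0 < C ∧ ∃ f : EuclideanSpace ℝ (Fin d) → ℝ,
        ContDiff ℝ ∞ f ∧ HasCompactSupport f ∧ bernsteinForm s p f ≤ -C) ∧
      (∃ D₁ D₂ α₁ α₂ : ℝ, 0 < D₁ ∧ 0 < D₂ ∧ 0 < α₁ ∧ 0 < α₂ ∧
        ∃ (N : ℕ → ℝ) (f : ℕ → SchwartzMap (EuclideanSpace ℝ (Fin d)) ℝ),
          (∀ j, 0 < N j) ∧ Filter.Tendsto N Filter.atTop Filter.atTop ∧
          ∀ j,
            tsupport (𝓕 (fun x : EuclideanSpace ℝ (Fin d) => ((f j x : ℝ) : ℂ))) ⊆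
              {ξ | α₁ * N j < 2 * Real.pi * ‖ξ‖ ∧ 2 * Real.pi * ‖ξ‖ < α₂ * N j} ∧
            -D₂ < bernsteinForm s p (f j) / (N j ^ s * ∫ x, |f j x| ^ p) ∧
            bernsteinForm s p (f j) / (N j ^ s * ∫ x, |f j x| ^ p) < -D₁) := by
  obtain ⟨a, p₁, h1, h2, hneg⟩ := exists_integral_waveDensity_neg hs
  have hs0 : 0 < s := by linarith
  obtain ⟨e, he⟩ : ∃ e : EuclideanSpace ℝ (Fin d), ‖e‖ = 1 :=
    ⟨EuclideanSpace.single ⟨0, hd⟩ 1, by simp⟩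
  refine ⟨p₁, h1, h2, fun p hp hp1 => ⟨?_, ?_⟩⟩
  · let b : ContDiffBump (0 : EuclideanSpace ℝ (Fin d)) := ⟨1, 2, by norm_num, by norm_num⟩
    obtain ⟨N, τ, hform⟩ := (eventually_exists_bernsteinForm_wavePacket_neg hs0 hp (hneg p hp hp1)
      he (b.hasCompactSupport.toSchwartzMap b.contDiff)
      ⟨0, (b.pos_of_mem_ball (by simp [b.rOut_pos])).ne'⟩).exists
    refine ⟨-_, neg_pos.mpr hform, _, ?_, ?_, (neg_neg _).ge⟩
    · exact ((contDiff_trigWave a).comp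
        ((contDiff_const.mul (contDiff_const.inner ℝ contDiff_id)).add contDiff_const)).mul b.contDiff
    · exact b.hasCompactSupport.mul_left
  · obtain ⟨φ, hφ, hsupp⟩ := exists_schwartzMap_fourier_eq_zero d
    -- Requiring `N > 1` keeps the annulus `N - 1 ≤ ‖ξ‖ ≤ 3N + 1` away from the origin.
    obtain ⟨N, ⟨τ, hform⟩, hN⟩ := ((eventually_exists_bernsteinForm_wavePacket_neg hs0 hp
      (hneg p hp hp1) he φ hφ).and (eventually_gt_atTop (1 : ℝ))).exists
    obtain ⟨F, hF⟩ := exists_schwartzMap_eq_wavePacket a N τ e φ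
    rw [← hF] at hform
    have hFne : ∃ x, F x ≠ 0 := by
      by_contra! hzero
      simp [bernsteinForm, hzero] at hform
    have hFpos := integral_abs_rpow_pos F.continuous (by linarith : 0 < p)
      (F.integrable_abs_rpow (by linarith)) hFne
    set r := bernsteinForm s p F / ∫ x, |F x| ^ p with hr
    have hrneg : r < 0 := div_neg_of_neg_of_pos hform hFpos
    have hπ := Real.pi_pos
    have hM : ∀ j : ℕ, 0 < (j : ℝ) + 1 := fun j => by positivity
    choose f hf using fun j => exists_schwartzMap_eq_comp_smul F (hM j)
    -- The ratio equals `r < 0` for every `j`, and `2r < r < r / 2`. The closed annulus in the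
    -- variable `2πξ` has radii `2π(N - 1)` and `2π(3N + 1)` times `j + 1`; halving the inner one
    -- and enlarging the outer one makes the inequalities strict.
    refine ⟨-r / 2, -r * 2, Real.pi * (N - 1), 2 * Real.pi * (3 * N + 2), by linarith, by linarith,
      mul_pos hπ (by linarith), by positivity, fun j => (j : ℝ) + 1, f, hM,
      tendsto_atTop_add_const_right _ _ tendsto_natCast_atTop_atTop, fun j => ⟨?_, ?_⟩⟩
    · simp only [hf]
      refine (tsupport_fourier_comp_smul_wavePacket_subset he hsupp (by linarith) (hM j) hF).trans
        fun ξ hξ => ?_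
      have hMj := hM j
      have hMN : 0 < ((j : ℝ) + 1) * (N - 1) := mul_pos hMj (by linarith)
      have h3 := mul_le_mul_of_nonneg_left hξ.1 hπ.le
      have h4 := mul_le_mul_of_nonneg_left hξ.2 hπ.le
      have h5 := mul_pos hπ hMN
      have h6 := mul_pos hπ hMj
      exact ⟨by linarith, by linarith⟩
    · simp only [hf, bernsteinForm_comp_smul_div s p (hM j) F, ← hr]
      exact ⟨by linarith, by linarith⟩
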